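/- Lemma 3. Let $f$ be a smooth $\mathbb{R}^m$-valued map on an open ball $\mathcal P$ about a state $\bar V\in\mathbb{R}^m$. Suppose that $f$ is hyperbolic with constant multiplicities on $\mathcal P$: for every $V\in\mathcal P$ the Jacobian $f_V(V)$ has exactly the distinct eigenvalues $\lambda^1(V)<\dots<\lambda^n(V)$, all real and semisimple, and $p_\beta=\dim R^\beta(V)$ does not depend on $V$, where $R^\beta(V)=\ker(f_V(V)-\lambda^\beta(V)I)$. Let $\hat A(V^-,V^+)$ be an averaged matrix for $f$, that is, a matrix that is smooth in $(V^-,V^+)\in\mathcal P\times\mathcal P$ and diagonalizable with real eigenvalues, with $\hat A(V,V)=f_V(V)$ and $\hat A(V^-,V^+)(V^+-V^-)=f(V^+)-f(V^-)$. Fix $\alpha\in\{1,\dots,n\}$ and let $W^\alpha$ be a smooth parametrization of the integral manifolds of $R^\alpha$ (the "contact manifolds"): $(V^-,s)\mapsto W^\alpha(V^-,s)\in\mathcal P$ is smooth on an open subset of $\mathcal P\times\mathbb{R}^{p_\alpha}$ that contains $\mathcal P\times\{0\}$, with $W^\alpha(V^-,0)=V^-$ and $\operatorname{Span}\{W^\alpha_{s^i}(V^-,s)\}_{i=1}^{p_\alpha}=R^\alpha(W^\alpha(V^-,s))$.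 Let $r>0$ be such that the closed discs $\{|z-\lambda^\beta(\bar V)|\le r\}$, $\beta=1,\dots,n$, are pairwise disjoint, and let $$\hat P^\alpha(V^-,V^+)=\frac1{2\pi i}\oint_{|z-\lambda^\alpha(\bar V)|=r}\bigl(zI-\hat A(V^-,V^+)\bigr)^{-1}\,dz$$ be the total projection for the $\alpha$-group of eigenvalues of $\hat A$. Then there is $\delta_0>0$ such that for every $\delta\in(0,\delta_0]$ there is an $\epsilon>0$ with $\mathcal P_\epsilon:=\{V:|V-\bar V|\le\epsilon\}\subset\mathcal P$ and the following property. For all $V^-,V\in\mathcal P_\epsilon$ and $s\in B_\delta(0)\subset\mathbb{R}^{p_\alpha}$, the point $W^\alpha(V^-,s)$ is defined and every eigenvalue of $\hat A(W^\alpha(V^-,s),V)$ lies in one of the open discs $\{|z-\lambda^\beta(\bar V)|<r\}$ (so that $\hat P^\alpha(W^\alpha(V^-,s),V)$ is well defined); and for all $V^-,V\in\mathcal P_\epsilon$ there is a unique $s=s(V^-,V)\in B_\delta(0)$ such that $$\hat P^\alpha\bigl(W^\alpha(V^-,s),V\bigr)\bigl(V-W^\alpha(V^-,s)\bigr)=0.$$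 -/

import Mathlib

open scoped ContDiff

noncomputable section

namespace SteadyFlow

/-- The state space `ℝᵐ` with its Euclidean norm. -/
abbrev State (m : ℕ) : Type := EuclideanSpace ℝ (Fin m)

/-- The eigenspace `ker (f_V(V) - μ I)` of the Jacobian of the flux `f` at the state `V`. -/
def eigSpace {m : ℕ} (f : State m → State m) (V : State m) (μ : ℝ) : Submodule ℝ (State m) :=
  LinearMap.ker ((fderiv ℝ f V - μ • ContinuousLinearMap.id ℝ (State m) :
    State m →L[ℝ] State m) : State m →ₗ[ℝ] State m)

/-- `f` is hyperbolic with constant multiplicities on the open set `Ω`: `f` is smooth there, and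
for `V ∈ Ω` the numbers `lam 0 V < ⋯ < lam (n-1) V` are the distinct eigenvalues of `f_V(V)`, all
of them real and semisimple, with multiplicities `p 0, …, p (n-1)` not depending on `V`.
(Eigenspaces to distinct eigenvalues are independent, so that the last two fields say that `ℝᵐ` is
their direct sum, and there are no other real or complex eigenvalues.) -/
structure IsHyperbolic {m n : ℕ} (f : State m → State m) (Ω : Set (State m))
    (lam : Fin n → State m → ℝ) (p : Fin n → ℕ) : Prop where
  smooth : ContDiffOn ℝ ∞ f Ω
  strictMono : ∀ V ∈ Ω, StrictMono (fun α => lam α V)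
  pos : ∀ α, 0 < p α
  finrank_eq : ∀ V ∈ Ω, ∀ α, Module.finrank ℝ (eigSpace f V (lam α V)) = p α
  sum_eq : ∑ α, p α = m

/-- `W` parametrizes, smoothly in the base point and in the parameter `s ∈ ℝᵖ`, the integral
manifolds in `Ω` of the field of eigenspaces `V ↦ ker (f_V(V) - lamα(V) I)`: the
map `s ↦ W V s` passes through `V` at `s = 0`, and at each of its points its partial derivatives
span the eigenspace at that point. It is defined for `(V, s)` in an open set `D` that contains
`Ω × {0}`. -/
structure IsCharacteristicParam {m p : ℕ} (f : State m → State m) (Ω : Set (State m))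
    (lamα : State m → ℝ) (D : Set (State m × EuclideanSpace ℝ (Fin p)))
    (W : State m → EuclideanSpace ℝ (Fin p) → State m) : Prop where
  isOpen : IsOpen D
  zero_mem : ∀ V ∈ Ω, (V, 0) ∈ D
  base_mem : ∀ V s, (V, s) ∈ D → V ∈ Ω
  map_mem : ∀ V s, (V, s) ∈ D → W V s ∈ Ω
  smooth : ContDiffOn ℝ ∞ (fun q : State m × EuclideanSpace ℝ (Fin p) => W q.1 q.2) D
  map_zero : ∀ V ∈ Ω, W V 0 = V
  span_eq : ∀ V s, (V, s) ∈ D →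
    Submodule.span ℝ (Set.range fun i : Fin p =>
      fderiv ℝ (W V) s (EuclideanSpace.single i (1 : ℝ))) = eigSpace f (W V s) (lamα (W V s))

/-- `A` is an averaged matrix for the flux `f` on `Ω`: it depends smoothly on the two states, is
diagonalizable with real eigenvalues, equals the Jacobian on the diagonal, and satisfies
`A(V⁻, V⁺) (V⁺ - V⁻) = f(V⁺) - f(V⁻)`. -/
structure IsAveragedMatrix {m : ℕ} (f : State m → State m) (Ω : Set (State m))
    (A : State m → State m → Matrix (Fin m) (Fin m) ℝ) : Prop where
  smooth : ∀ i j, ContDiffOn ℝ ∞ (fun q : State m × State m => A q.1 q.2 i j) (Ω ×ˢ Ω)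
  diagonalizable : ∀ V₁ ∈ Ω, ∀ V₂ ∈ Ω, ∃ (T : Matrix (Fin m) (Fin m) ℝ) (d : Fin m → ℝ),
    IsUnit T.det ∧ A V₁ V₂ * T = T * Matrix.diagonal d
  diag : ∀ V ∈ Ω, Matrix.toEuclideanCLM (𝕜 := ℝ) (A V V) = fderiv ℝ f V
  jump : ∀ V₁ ∈ Ω, ∀ V₂ ∈ Ω,
    Matrix.toEuclideanCLM (𝕜 := ℝ) (A V₁ V₂) (V₂ - V₁) = f V₂ - f V₁

/-- A real matrix as an operator on `ℂᵐ`. -/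
def complexOp {m : ℕ} (M : Matrix (Fin m) (Fin m) ℝ) :
    EuclideanSpace ℂ (Fin m) →L[ℂ] EuclideanSpace ℂ (Fin m) :=
  Matrix.toEuclideanCLM (𝕜 := ℂ) (M.map Complex.ofReal)

/-- A real vector as a vector in `ℂᵐ`. -/
def complexVec {m : ℕ} (v : State m) : EuclideanSpace ℂ (Fin m) :=
  WithLp.toLp 2 fun i => (v i : ℂ)

/-- The total projection `(2πi)⁻¹ ∮ (z I - M)⁻¹ dz`, over the counterclockwise circle
`|z - c| = r`, for the group of eigenvalues of `M` inside this circle. -/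
def totalProj {m : ℕ} (c r : ℝ) (M : Matrix (Fin m) (Fin m) ℝ) :
    EuclideanSpace ℂ (Fin m) →L[ℂ] EuclideanSpace ℂ (Fin m) :=
  (2 * (Real.pi : ℂ) * Complex.I)⁻¹ • ∮ z in C((c : ℂ), r), resolvent (complexOp M) z

end SteadyFlow

end

/-!
Near the base state the matrix `M = Â(W(V⁻, s), V)` is diagonalizable with real spectrum off the
circle, so its total projection is the complexification of a real projection `Q`, and the second
resolvent identity makes `Q` locally Lipschitz in the states. At the base state `Q` is the
projection onto `R^α(V̄)`, which is the range of `W_s`, and the jump `V - W(V⁻, s)` vanishes there.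
Hence `Q (V - W(V⁻, s))` is strictly differentiable at the base state, although `Q` is only
Lipschitz, and its derivative in `s` is `-W_s`, which is injective with range that of `Q`. Apply
the projection `Q₀` at the base state and a left inverse of `-W_s` on its range: the implicit
function theorem solves the resulting equation uniquely for `s`. No zero is gained in passing to
`Q₀`, because two projections at distance less than `1` satisfy `ker Q₀ ∩ range Q = 0`.
-/

namespace SteadyFlow

open Filter Topology Asymptotics Metric

section LipschitzNear

variable {X Y Z : Type*} [NormedAddCommGroup X] [NormedAddCommGroup Y] [NormedAddCommGroup Z]

/-- `f` is Lipschitz on some neighbourhood of `x₀`. The Lipschitz constant is hidden in a Landau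
symbol, in the form in which strict differentiability produces it. -/
def LipschitzNear (f : X → Y) (x₀ : X) : Prop :=
  (fun q : X × X => f q.1 - f q.2) =O[𝓝 (x₀, x₀)] fun q => q.1 - q.2

theorem LipschitzNear.continuousAt {f : X → Y} {x₀ : X} (hf : LipschitzNear f x₀) :
    ContinuousAt f x₀ := by
  have hdiag : Tendsto (fun x : X => (x, x₀)) (𝓝 x₀) (𝓝 (x₀, x₀)) :=
    (Continuous.prodMk_left x₀).tendsto x₀
  exact tendsto_sub_nhds_zero_iff.1
    ((hf.comp_tendsto hdiag).trans_tendsto (tendsto_sub_nhds_zero_iff.2 tendsto_id))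

theorem LipschitzNear.comp {g : Y → Z} {f : X → Y} {x₀ : X} (hg : LipschitzNear g (f x₀))
    (hf : LipschitzNear f x₀) : LipschitzNear (fun x => g (f x)) x₀ :=
  (hg.comp_tendsto (hf.continuousAt.prodMap' hf.continuousAt)).trans hf

theorem LipschitzNear.of_hasStrictFDerivAt {E F : Type*} [NormedAddCommGroup E] [NormedSpace ℝ E]
    [NormedAddCommGroup F] [NormedSpace ℝ F] {f : E → F} {f' : E →L[ℝ] F} {x₀ : E}
    (hf : HasStrictFDerivAt f f' x₀) : LipschitzNear f x₀ :=
  hf.isBigO_sub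

end LipschitzNear

section RieszProjection

variable {B B' : Type*} [NormedRing B] [NormedAlgebra ℂ B] [CompleteSpace B]
  [NormedRing B'] [NormedAlgebra ℂ B'] [CompleteSpace B']

/-- The Riesz projection `(2πi)⁻¹ ∮ (z - a)⁻¹ dz` of an element `a` of a complex Banach algebra,
over the counterclockwise circle `|z - c| = r`. -/
noncomputable def rieszProj (c : ℂ) (r : ℝ) (a : B) : B :=
  (2 * (Real.pi : ℂ) * Complex.I)⁻¹ • ∮ z in C(c, r), resolvent a z

theorem continuousOn_resolvent {a : B} {S : Set ℂ} (ha : S ⊆ resolventSet ℂ a) :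
    ContinuousOn (resolvent a) S := fun _ hz =>
  (spectrum.hasDerivAt_resolvent_const_left (ha hz)).continuousAt.continuousWithinAt

theorem circleIntegrable_resolvent {a : B} {c : ℂ} {r : ℝ} (hr : 0 ≤ r)
    (ha : sphere c r ⊆ resolventSet ℂ a) : CircleIntegrable (resolvent a) c r :=
  (continuousOn_resolvent ha).circleIntegrable hr

theorem exists_eventually_norm_resolvent_le {a : B} {K : Set ℂ} (hK : IsCompact K)
    (ha : K ⊆ resolventSet ℂ a) :
    ∃ C, ∀ᶠ b in 𝓝 a, ∀ z ∈ K, z ∈ resolventSet ℂ b ∧ ‖resolvent b z‖ ≤ C := by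
  obtain ⟨C, hC⟩ := hK.exists_bound_of_continuousOn (continuousOn_resolvent ha)
  refine ⟨C + 1, hK.eventually_forall_of_forall_eventually fun z hz => ?_⟩
  have hsub : ContinuousAt (fun q : B × ℂ => algebraMap ℂ B q.2 - q.1) (a, z) := by fun_prop
  have hres : ContinuousAt (fun q : B × ℂ => resolvent q.1 q.2) (a, z) :=
    ContinuousAt.comp (f := fun q : B × ℂ => algebraMap ℂ B q.2 - q.1)
      (NormedRing.inverse_continuousAt (ha hz).unit) hsub
  filter_upwards [hsub.eventually (Units.isOpen.mem_nhds (ha hz)),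
    hres.norm.eventually (gt_mem_nhds ((hC z hz).trans_lt (lt_add_one C)))] with q hunit hlt
  exact ⟨hunit, hlt.le⟩

theorem norm_rieszProj_sub_le {a b : B} {c : ℂ} {r C : ℝ} (hr : 0 ≤ r)
    (ha : ∀ z ∈ sphere c r, z ∈ resolventSet ℂ a ∧ ‖resolvent a z‖ ≤ C)
    (hb : ∀ z ∈ sphere c r, z ∈ resolventSet ℂ b ∧ ‖resolvent b z‖ ≤ C) :
    ‖rieszProj c r a - rieszProj c r b‖ ≤ r * (C * C) * ‖a - b‖ := by
  rw [rieszProj, rieszProj, ← smul_sub, ← circleIntegral.integral_sub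
    (circleIntegrable_resolvent hr fun z hz => (ha z hz).1)
    (circleIntegrable_resolvent hr fun z hz => (hb z hz).1)]
  refine (circleIntegral.norm_two_pi_i_inv_smul_integral_le_of_norm_le_const hr
    (C := C * ‖a - b‖ * C) fun z hz => ?_).trans_eq (by ring)
  have hC : 0 ≤ C := (norm_nonneg _).trans (ha z hz).2
  rw [spectrum.resolvent_sub_resolvent (ha z hz).1 (hb z hz).1]
  calc ‖resolvent a z * (a - b) * resolvent b z‖
      ≤ ‖resolvent a z‖ * ‖a - b‖ * ‖resolvent b z‖ := norm_mul₃_le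
    _ ≤ C * ‖a - b‖ * C := by
        gcongr
        exacts [(ha z hz).2, (hb z hz).2]

theorem lipschitzNear_rieszProj {a : B} {c : ℂ} {r : ℝ} (hr : 0 ≤ r)
    (ha : sphere c r ⊆ resolventSet ℂ a) : LipschitzNear (rieszProj c r) a := by
  obtain ⟨C, hC⟩ := exists_eventually_norm_resolvent_le (isCompact_sphere c r) ha
  refine IsBigO.of_bound (r * (C * C)) ?_
  rw [nhds_prod_eq]
  filter_upwards [hC.prod_mk hC] with q hq
  exact norm_rieszProj_sub_le hr hq.1 hq.2

theorem map_resolvent {R A A' : Type*} [CommRing R] [Ring A] [Algebra R A] [Ring A'] [Algebra R A']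
    (φ : A →ₐ[R] A') {a : A} {z : R} (ha : z ∈ resolventSet R a) :
    φ (resolvent a z) = resolvent (φ a) z := by
  have hmap : algebraMap R A' z - φ a = Units.map (φ : A →* A') ha.unit :=
    (map_sub φ _ _).trans (by rw [φ.commutes]) |>.symm
  rw [spectrum.resolvent_eq ha, resolvent, hmap, Ring.inverse_unit]
  rfl

theorem map_rieszProj (φ : B →ₐ[ℂ] B') (hφ : Continuous φ) {a : B} {c : ℂ} {r : ℝ} (hr : 0 ≤ r)
    (ha : sphere c r ⊆ resolventSet ℂ a) :
    φ (rieszProj c r a) = rieszProj c r (φ a) := by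
  let L : B →L[ℂ] B' := ⟨φ.toLinearMap, hφ⟩
  have hint : L (∮ z in C(c, r), resolvent a z) = ∮ z in C(c, r), L (resolvent a z) := by
    simp only [circleIntegral, ← map_smul]
    exact (L.intervalIntegral_comp_comm (circleIntegrable_resolvent hr ha).out).symm
  change L ((2 * (Real.pi : ℂ) * Complex.I)⁻¹ • ∮ z in C(c, r), resolvent a z) = _
  rw [map_smul, hint, rieszProj,
    circleIntegral.integral_congr hr fun z hz => (map_resolvent φ (ha hz)).symm]
  rfl

theorem rieszProj_scalar {c w : ℂ} {r : ℝ} (hr : 0 < r) (hw : w ∉ sphere c r) :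
    rieszProj c r w = (ball c r).indicator 1 w := by
  simp only [rieszProj, resolvent, Algebra.algebraMap_self_apply, Ring.inverse_eq_inv']
  by_cases hball : w ∈ ball c r
  · rw [circleIntegral.integral_sub_inv_of_mem_ball hball, smul_eq_mul,
      inv_mul_cancel₀ Complex.two_pi_I_ne_zero, Set.indicator_of_mem hball, Pi.one_apply]
  · have hout : w ∉ closedBall c r := fun hw' =>
      (ball_union_sphere.ge hw').elim hball hw
    have hne : ∀ z ∈ closedBall c r, z - w ≠ 0 := fun z hz hzw =>
      hout (sub_eq_zero.1 hzw ▸ hz)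
    rw [Complex.circleIntegral_eq_zero_of_differentiable_on_off_countable hr.le
      Set.countable_empty (by fun_prop (disch := assumption))
      fun z hz => by
        have := hne z (ball_subset_closedBall hz.1)
        fun_prop (disch := assumption), smul_zero, Set.indicator_of_notMem hball]

theorem subset_resolventSet_pi {ι 𝕜 : Type*} [Field 𝕜] {d : ι → 𝕜} {S : Set 𝕜}
    (hd : ∀ i, d i ∉ S) : S ⊆ resolventSet 𝕜 d := fun z hz =>
  spectrum.mem_resolventSet_iff.2 <| Pi.isUnit_iff.2 fun i =>
    (sub_ne_zero.2 fun h : z = d i => hd i (h ▸ hz)).isUnit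

theorem rieszProj_pi {ι : Type*} [Fintype ι] {d : ι → ℂ} {c : ℂ} {r : ℝ} (hr : 0 < r)
    (hd : ∀ i, d i ∉ sphere c r) :
    rieszProj c r d = (ball c r).indicator 1 ∘ d := by
  ext i
  exact (map_rieszProj (Pi.evalAlgHom ℂ _ i) (continuous_apply i) hr.le
    (subset_resolventSet_pi hd)).trans (rieszProj_scalar hr (hd i))

theorem rieszProj_map_pi {ι : Type*} [Finite ι] (φ : (ι → ℂ) →ₐ[ℂ] B) {d : ι → ℂ} {c : ℂ} {r : ℝ}
    (hr : 0 < r) (hd : ∀ i, d i ∉ sphere c r) :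
    rieszProj c r (φ d) = φ ((ball c r).indicator 1 ∘ d) := by
  cases nonempty_fintype ι
  rw [← rieszProj_pi hr hd, map_rieszProj φ φ.toLinearMap.continuous_of_finiteDimensional hr.le
    (subset_resolventSet_pi hd)]

end RieszProjection

section Diagonalizable

variable {n R K : Type*} [Fintype n] [DecidableEq n] [CommRing R] [Field K]

/-- The algebra of the matrices that become diagonal in the basis of the columns of `T`,
parametrized by the eigenvalues: `d ↦ T * diagonal d * T⁻¹`. Being an algebra homomorphism, it
turns a function of the eigenvalues into the same function of the matrix. -/
def diagConj (T : (Matrix n n R)ˣ) : (n → R) →ₐ[R] Matrix n n R :=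
  (MulSemiringAction.toAlgHom R (Matrix n n R) (ConjAct.toConjAct T)).comp
    (Matrix.diagonalAlgHom R)

theorem diagConj_apply (T : (Matrix n n R)ˣ) (d : n → R) :
    diagConj T d = T * Matrix.diagonal d * ((T⁻¹ : (Matrix n n R)ˣ) : Matrix n n R) :=
  ConjAct.units_smul_def _ _

theorem mapMatrix_diagConj {S : Type*} [CommRing S] (f : R →+* S) (T : (Matrix n n R)ˣ)
    (d : n → R) :
    f.mapMatrix (diagConj T d) = diagConj (Units.map f.mapMatrix.toMonoidHom T) (f ∘ d) := by
  rw [diagConj_apply, diagConj_apply, map_mul, map_mul]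
  congr 2
  exact Matrix.diagonal_map (map_zero f)

/-- A square matrix is diagonalizable over the ring of its entries. -/
def IsDiagonalizable (M : Matrix n n R) : Prop :=
  ∃ T d, M = diagConj T d

theorem IsDiagonalizable.of_mul_eq_mul_diagonal {M T : Matrix n n R} {d : n → R}
    (hT : IsUnit T.det) (h : M * T = T * Matrix.diagonal d) : IsDiagonalizable M := by
  refine ⟨T.nonsingInvUnit hT, d, ?_⟩
  rw [diagConj_apply, Units.eq_mul_inv_iff_mul_eq]
  exact h

theorem spectrum_diagConj (T : (Matrix n n K)ˣ) (d : n → K) :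
    spectrum K (diagConj T d) = Set.range d := by
  rw [diagConj_apply, spectrum.units_conjugate, spectrum_diagonal]

theorem range_indicator_eq_eigenspace {ι V : Type*} [AddCommGroup V] [Module K V]
    (φ : (ι → K) →ₐ[K] Module.End K V) (d : ι → K) (c : K) :
    LinearMap.range (φ (({c} : Set K).indicator 1 ∘ d)) = (φ d).eigenspace c := by
  classical
  apply le_antisymm
  · rintro _ ⟨v, rfl⟩
    rw [Module.End.mem_eigenspace_iff, ← Module.End.mul_apply, ← map_mul]
    have hmul : d * ({c} : Set K).indicator 1 ∘ d = c • ({c} : Set K).indicator 1 ∘ d := by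
      ext i
      by_cases hi : d i = c <;> simp [hi]
    rw [hmul, map_smul, LinearMap.smul_apply]
  · intro v hv
    have hinv : 1 - ({c} : Set K).indicator 1 ∘ d =
        (fun i => (d i - c)⁻¹) * (d - algebraMap K _ c) := by
      ext i
      by_cases hi : d i = c
      · simp [hi]
      · simp [hi, sub_ne_zero.2 hi]
    have hker : φ (d - algebraMap K _ c) v = 0 := by
      rw [map_sub, AlgHom.commutes, LinearMap.sub_apply, Module.algebraMap_end_apply,
        Module.End.mem_eigenspace_iff.1 hv, sub_self]
    refine ⟨v, (sub_eq_zero.1 ?_).symm⟩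
    have := congrArg (fun x => φ x v) hinv
    rwa [map_sub, map_one, map_mul, Module.End.mul_apply, hker, map_zero] at this

end Diagonalizable

section Complexification

variable {m : ℕ}

/-- Complexification of real matrices, as a homomorphism of real algebras. -/
noncomputable def complexOpHom (m : ℕ) : Matrix (Fin m) (Fin m) ℝ →ₐ[ℝ]
    (EuclideanSpace ℂ (Fin m) →L[ℂ] EuclideanSpace ℂ (Fin m)) :=
  (((Matrix.toEuclideanCLM (n := Fin m) (𝕜 := ℂ)).toAlgEquiv : _ →ₐ[ℂ] _).restrictScalars ℝ).comp
    Complex.ofRealAm.mapMatrix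

theorem lipschitzNear_complexOp {X : Type*} [NormedAddCommGroup X]
    {M : X → Matrix (Fin m) (Fin m) ℝ} {x₀ : X} (hM : ∀ i j, LipschitzNear (fun x => M x i j) x₀) :
    LipschitzNear (fun x => complexOp (M x)) x₀ := by
  let L : (Fin m → Fin m → ℝ) →L[ℝ] (EuclideanSpace ℂ (Fin m) →L[ℂ] EuclideanSpace ℂ (Fin m)) :=
    LinearMap.toContinuousLinearMap
      ((complexOpHom m).toLinearMap ∘ₗ (Matrix.ofLinearEquiv ℝ).toLinearMap)
  have hL : LipschitzNear (fun x => L fun i j => M x i j) x₀ := by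
    simp only [LipschitzNear, ← map_sub]
    exact (L.isBigO_comp _ _).trans (isBigO_pi.2 fun i => isBigO_pi.2 fun j => hM i j)
  exact hL

theorem complexOp_diagConj (T : (Matrix (Fin m) (Fin m) ℝ)ˣ) (d : Fin m → ℝ) :
    complexOp (diagConj T d) = Matrix.toEuclideanCLM (𝕜 := ℂ)
      (diagConj (Units.map Complex.ofRealHom.mapMatrix.toMonoidHom T) (Complex.ofReal ∘ d)) :=
  congrArg (Matrix.toEuclideanCLM (n := Fin m) (𝕜 := ℂ)) (mapMatrix_diagConj Complex.ofRealHom T d)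

theorem IsDiagonalizable.spectrum_complexOp {M : Matrix (Fin m) (Fin m) ℝ}
    (hM : IsDiagonalizable M) :
    spectrum ℂ (complexOp M) = Complex.ofReal '' spectrum ℝ M := by
  obtain ⟨T, d, rfl⟩ := hM
  rw [complexOp_diagConj, AlgEquiv.spectrum_eq, spectrum_diagConj, spectrum_diagConj,
    Set.range_comp]

theorem totalProj_diagConj (T : (Matrix (Fin m) (Fin m) ℝ)ˣ) {d : Fin m → ℝ} {c r : ℝ}
    (hr : 0 < r) (hd : ∀ i, d i ∉ sphere c r) :
    totalProj c r (diagConj T d) = complexOp (diagConj T ((ball c r).indicator 1 ∘ d)) := by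
  have hball (t : ℝ) : (ball (c : ℂ) r).indicator 1 (t : ℂ) =
      (((ball c r).indicator 1 t : ℝ) : ℂ) := by
    rw [← Complex.isometry_ofReal.preimage_ball c r]
    by_cases ht : (t : ℂ) ∈ ball (c : ℂ) r
    · rw [Set.indicator_of_mem ht, Set.indicator_of_mem (Set.mem_preimage.2 ht)]
      simp
    · rw [Set.indicator_of_notMem ht, Set.indicator_of_notMem (Set.mem_preimage.not.2 ht)]
      simp
  have hsphere (i : Fin m) : (Complex.ofReal ∘ d) i ∉ sphere (c : ℂ) r := by
    have := hd i
    rwa [← Complex.isometry_ofReal.preimage_sphere c r] at this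
  let φ : (Fin m → ℂ) →ₐ[ℂ] (EuclideanSpace ℂ (Fin m) →L[ℂ] EuclideanSpace ℂ (Fin m)) :=
    ((Matrix.toEuclideanCLM (n := Fin m) (𝕜 := ℂ)).toAlgEquiv : _ →ₐ[ℂ] _).comp
      (diagConj (Units.map Complex.ofRealHom.mapMatrix.toMonoidHom T))
  calc totalProj c r (diagConj T d) = rieszProj c r (φ (Complex.ofReal ∘ d)) :=
        congrArg (rieszProj (c : ℂ) r) (complexOp_diagConj T d)
    _ = φ (Complex.ofReal ∘ (ball c r).indicator 1 ∘ d) := by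
        rw [rieszProj_map_pi φ hr hsphere]
        exact congrArg φ (funext fun i => hball (d i))
    _ = complexOp (diagConj T ((ball c r).indicator 1 ∘ d)) := (complexOp_diagConj T _).symm

theorem IsDiagonalizable.exists_totalProj_eq_complexOp {M : Matrix (Fin m) (Fin m) ℝ}
    (hM : IsDiagonalizable M) {c r : ℝ} (hr : 0 < r) (hs : Disjoint (spectrum ℝ M) (sphere c r)) :
    ∃ N, IsIdempotentElem N ∧ totalProj c r M = complexOp N := by
  obtain ⟨T, d, rfl⟩ := hM
  rw [spectrum_diagConj] at hs
  refine ⟨_, IsIdempotentElem.map ?_ (diagConj T),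
    totalProj_diagConj T hr fun i => Set.disjoint_left.1 hs ⟨i, rfl⟩⟩
  ext i
  by_cases hi : d i ∈ ball c r <;> simp [hi]

theorem complexOp_complexVec (M : Matrix (Fin m) (Fin m) ℝ) (v : State m) :
    complexOp M (complexVec v) = complexVec (Matrix.toEuclideanCLM (𝕜 := ℝ) M v) := by
  ext i
  simp [complexOp, complexVec, Matrix.ofLp_toEuclideanCLM, Matrix.mulVec, dotProduct]

/-- The inclusion of real into complex vectors, as a continuous linear map. -/
noncomputable def complexVecL (m : ℕ) : State m →L[ℝ] EuclideanSpace ℂ (Fin m) :=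
  LinearMap.toContinuousLinearMap
    { toFun := complexVec
      map_add' := fun v w => by ext i; simp [complexVec]
      map_smul' := fun c v => by ext i; simp [complexVec] }

/-- The coordinatewise real part of a complex vector. -/
noncomputable def reVec (m : ℕ) : EuclideanSpace ℂ (Fin m) →L[ℝ] State m :=
  LinearMap.toContinuousLinearMap
    { toFun := fun v => WithLp.toLp 2 fun i => (v i).re
      map_add' := fun v w => by ext i; simp
      map_smul' := fun c v => by ext i; simp }

theorem reVec_complexVec (v : State m) : reVec m (complexVec v) = v := rfl

theorem complexVec_eq_zero {v : State m} : complexVec v = 0 ↔ v = 0 :=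
  map_eq_zero_iff (complexVecL m) (Function.LeftInverse.injective reVec_complexVec)

/-- The real part of an operator on `ℂᵐ`, as an operator on `ℝᵐ`. It recovers a real matrix from its
complexification. -/
noncomputable def reOp (m : ℕ) :
    (EuclideanSpace ℂ (Fin m) →L[ℂ] EuclideanSpace ℂ (Fin m)) →L[ℝ] State m →L[ℝ] State m :=
  (ContinuousLinearMap.compL ℝ _ _ _ (reVec m)) ∘L
    ((ContinuousLinearMap.compL ℝ _ _ _).flip (complexVecL m)) ∘L
      ContinuousLinearMap.restrictScalarsL ℂ _ _ ℝ ℝ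

theorem reOp_complexOp (M : Matrix (Fin m) (Fin m) ℝ) :
    reOp m (complexOp M) = Matrix.toEuclideanCLM (𝕜 := ℝ) M := by
  ext1 v
  exact (congrArg (reVec m) (complexOp_complexVec M v)).trans (reVec_complexVec _)

theorem IsDiagonalizable.range_reOp_totalProj {M : Matrix (Fin m) (Fin m) ℝ}
    (hM : IsDiagonalizable M) {c r : ℝ} (hr : 0 < r)
    (hs : spectrum ℝ M ∩ closedBall c r ⊆ {c}) :
    LinearMap.range (reOp m (totalProj c r M) : State m →ₗ[ℝ] State m) =
      Module.End.eigenspace (Matrix.toEuclideanCLM (𝕜 := ℝ) M : State m →ₗ[ℝ] State m) c := by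
  obtain ⟨T, d, rfl⟩ := hM
  rw [spectrum_diagConj] at hs
  have hsphere (i : Fin m) : d i ∉ sphere c r := fun hi => by
    have hc : d i = c := hs ⟨⟨i, rfl⟩, sphere_subset_closedBall hi⟩
    rw [hc, mem_sphere, dist_self] at hi
    exact hr.ne hi
  have hball : (ball c r).indicator (1 : ℝ → ℝ) ∘ d = ({c} : Set ℝ).indicator 1 ∘ d := by
    ext i
    by_cases hi : d i = c
    · simp [hi, hr]
    · have hout : d i ∉ ball c r := fun h => hi (hs ⟨⟨i, rfl⟩, ball_subset_closedBall h⟩)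
      simp [hi, hout]
  rw [totalProj_diagConj T hr hsphere, reOp_complexOp, hball]
  exact range_indicator_eq_eigenspace
    ((Matrix.toLpLinAlgEquiv (R := ℝ) (n := Fin m) 2).toAlgHom.comp (diagConj T)) d c

end Complexification

section ImplicitFunction

variable {X Y E F G : Type*} [NormedAddCommGroup X] [NormedSpace ℝ X]
  [NormedAddCommGroup Y] [NormedSpace ℝ Y] [NormedAddCommGroup E] [NormedSpace ℝ E]
  [NormedAddCommGroup F] [NormedSpace ℝ F] [NormedAddCommGroup G] [NormedSpace ℝ G]

theorem hasStrictFDerivAt_apply_of_eq_zero {Q : X → E →L[ℝ] G} {v : X → E} {v' : X →L[ℝ] E}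
    {x₀ : X} (hQ : LipschitzNear Q x₀) (hv : HasStrictFDerivAt v v' x₀) (h0 : v x₀ = 0) :
    HasStrictFDerivAt (fun x => Q x (v x)) (Q x₀ ∘L v') x₀ := by
  have hQ0 : (fun q : X × X => Q q.1 - Q x₀) =o[𝓝 (x₀, x₀)] fun _ => (1 : ℝ) :=
    (isLittleO_one_iff ℝ).2 <| tendsto_sub_nhds_zero_iff.2 <|
      hQ.continuousAt.tendsto.comp (continuous_fst.tendsto (x₀, x₀))
  have hv0 : (fun q : X × X => v q.2) =o[𝓝 (x₀, x₀)] fun _ => (1 : ℝ) :=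
    (isLittleO_one_iff ℝ).2 <| (h0 ▸ hv.continuousAt.tendsto : Tendsto v (𝓝 x₀) (𝓝 0)).comp
      (continuous_snd.tendsto (x₀, x₀))
  have hvary : (fun q : X × X => (Q q.1 - Q x₀) (v q.1 - v q.2)) =o[𝓝 (x₀, x₀)]
      fun q => q.1 - q.2 :=
    isBoundedBilinearMap_apply.isBigO_comp.trans_isLittleO <|
      (hQ0.norm_left.mul_isBigO hv.isBigO_sub.norm_norm).trans_isBigO
        (by simpa only [one_mul] using (isBigO_refl _ _).norm_left)
  have hshift : (fun q : X × X => (Q q.1 - Q q.2) (v q.2)) =o[𝓝 (x₀, x₀)]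
      fun q => q.1 - q.2 :=
    isBoundedBilinearMap_apply.isBigO_comp.trans_isLittleO <|
      (hQ.norm_norm.mul_isLittleO hv0.norm_left).trans_isBigO
        (by simpa only [mul_one] using (isBigO_refl _ _).norm_left)
  have hfrozen := ((Q x₀).hasStrictFDerivAt.comp x₀ hv).isLittleO
  refine .of_isLittleO (((hvary.add hshift).add hfrozen).congr_left fun q => ?_)
  simp only [sub_apply, map_sub]
  abel

theorem apply_eq_zero_of_norm_sub_lt_one {q q₀ : E →L[ℝ] E} (hq : IsIdempotentElem q)
    (hlt : ‖q - q₀‖ < 1) {v : E} (hv : q₀ (q v) = 0) : q v = 0 := by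
  have hfix : (q - q₀) (q v) = q v := by
    rw [sub_apply, hv, sub_zero]
    exact DFunLike.congr_fun hq v
  have hle := (q - q₀).le_opNorm (q v)
  rw [hfix] at hle
  by_contra hne
  exact (mul_lt_of_lt_one_left (norm_pos_iff.2 hne) hlt).not_ge hle

theorem exists_implicitFunction_of_idempotent [CompleteSpace Y] [CompleteSpace F]
    {Q : Y × F → E →L[ℝ] E} {v : Y × F → E} {v' : Y × F →L[ℝ] E} {x₀ : Y × F}
    (hQ : LipschitzNear Q x₀) (hid : ∀ᶠ x in 𝓝 x₀, IsIdempotentElem (Q x))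
    (hv : HasStrictFDerivAt v v' x₀) (h0 : v x₀ = 0)
    (hleft : (v' ∘L .inr ℝ Y F).HasLeftInverse)
    (hrange : LinearMap.range (Q x₀ : E →ₗ[ℝ] E) =
      LinearMap.range (v' ∘L .inr ℝ Y F : F →ₗ[ℝ] E)) :
    ∃ φ : Y → F, Tendsto φ (𝓝 x₀.1) (𝓝 x₀.2) ∧ ∀ᶠ x in 𝓝 x₀, Q x (v x) = 0 ↔ φ x.1 = x.2 := by
  obtain ⟨π, hleft⟩ := hleft
  have hπ (s : F) : π (v' (0, s)) = s := hleft s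
  have hfix (s : F) : Q x₀ (v' (0, s)) = v' (0, s) := by
    obtain ⟨w, hw⟩ := hrange.ge ⟨s, rfl⟩
    change Q x₀ w = v' (0, s) at hw
    rw [← hw]
    exact DFunLike.congr_fun hid.self_of_nhds w
  have hd : HasStrictFDerivAt (fun x => π (Q x₀ (Q x (v x)))) ((π ∘L Q x₀) ∘L (Q x₀ ∘L v')) x₀ :=
    (π ∘L Q x₀).hasStrictFDerivAt.comp x₀ (hasStrictFDerivAt_apply_of_eq_zero hQ hv h0)
  have hinv : (((π ∘L Q x₀) ∘L (Q x₀ ∘L v')) ∘L .inr ℝ Y F).IsInvertible := by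
    refine ⟨.refl ℝ F, ?_⟩
    ext1 s
    simp [hfix, hπ]
  refine ⟨hd.implicitFunctionOfProdDomain hinv, hd.tendsto_implicitFunctionOfProdDomain hinv, ?_⟩
  have hclose : ∀ᶠ x in 𝓝 x₀, ‖Q x - Q x₀‖ < 1 :=
    (tendsto_iff_norm_sub_tendsto_zero.1 hQ.continuousAt).eventually_lt_const one_pos
  filter_upwards [hd.eventually_apply_eq_iff_implicitFunctionOfProdDomain hinv, hid, hclose]
    with x hx hidx hlt
  rw [← hx, h0, map_zero, map_zero, map_zero]
  refine ⟨fun h => by rw [h, map_zero, map_zero], fun h => ?_⟩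
  obtain ⟨s, hs⟩ := hrange.le ⟨Q x (v x), rfl⟩
  change v' (0, s) = Q x₀ (Q x (v x)) at hs
  rw [← hs, hπ] at h
  exact apply_eq_zero_of_norm_sub_lt_one hidx hlt (by rw [← hs, h]; exact map_zero v')

end ImplicitFunction

section TotalProjection

variable {m : ℕ}

theorem IsDiagonalizable.sphere_subset_resolventSet_iff {M : Matrix (Fin m) (Fin m) ℝ}
    (hM : IsDiagonalizable M) {c r : ℝ} :
    sphere (c : ℂ) r ⊆ resolventSet ℂ (complexOp M) ↔ Disjoint (spectrum ℝ M) (sphere c r) := by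
  rw [← Complex.isometry_ofReal.preimage_sphere c r, ← Set.disjoint_image_left,
    ← hM.spectrum_complexOp, ← Set.subset_compl_iff_disjoint_left, spectrum, compl_compl]

theorem IsDiagonalizable.isIdempotentElem_reOp_totalProj {M : Matrix (Fin m) (Fin m) ℝ}
    (hM : IsDiagonalizable M) {c r : ℝ} (hr : 0 < r) (hs : Disjoint (spectrum ℝ M) (sphere c r)) :
    IsIdempotentElem (reOp m (totalProj c r M)) := by
  obtain ⟨N, hN, hMN⟩ := hM.exists_totalProj_eq_complexOp hr hs
  rw [hMN, reOp_complexOp]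
  exact hN.map _

theorem IsDiagonalizable.totalProj_complexVec_eq_zero_iff {M : Matrix (Fin m) (Fin m) ℝ}
    (hM : IsDiagonalizable M) {c r : ℝ} (hr : 0 < r) (hs : Disjoint (spectrum ℝ M) (sphere c r))
    {v : State m} :
    totalProj c r M (complexVec v) = 0 ↔ reOp m (totalProj c r M) v = 0 := by
  obtain ⟨N, -, hMN⟩ := hM.exists_totalProj_eq_complexOp hr hs
  rw [hMN, reOp_complexOp, complexOp_complexVec, complexVec_eq_zero]

theorem lipschitzNear_reOp_totalProj {X : Type*} [NormedAddCommGroup X]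
    {M : X → Matrix (Fin m) (Fin m) ℝ} {x₀ : X} (hM : LipschitzNear (fun x => complexOp (M x)) x₀)
    {c r : ℝ} (hr : 0 ≤ r) (hs : sphere (c : ℂ) r ⊆ resolventSet ℂ (complexOp (M x₀))) :
    LipschitzNear (fun x => reOp m (totalProj c r (M x))) x₀ :=
  (LipschitzNear.of_hasStrictFDerivAt (reOp m).hasStrictFDerivAt).comp
    ((lipschitzNear_rieszProj hr hs).comp (f := fun x => complexOp (M x)) hM)

theorem eventually_disjoint_spectrum_sphere {X : Type*} [TopologicalSpace X]
    {M : X → Matrix (Fin m) (Fin m) ℝ} {x₀ : X} (hM : ContinuousAt (fun x => complexOp (M x)) x₀)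
    (hdiag : ∀ᶠ x in 𝓝 x₀, IsDiagonalizable (M x)) {c r : ℝ}
    (hs : sphere (c : ℂ) r ⊆ resolventSet ℂ (complexOp (M x₀))) :
    ∀ᶠ x in 𝓝 x₀, Disjoint (spectrum ℝ (M x)) (sphere c r) := by
  obtain ⟨C, hC⟩ := exists_eventually_norm_resolvent_le (isCompact_sphere (c : ℂ) r) hs
  filter_upwards [hdiag, hM.eventually hC] with x hx hres
  exact hx.sphere_subset_resolventSet_iff.1 fun z hz => (hres z hz).1

theorem eventually_spectrum_complexOp_subset {X : Type*} [TopologicalSpace X]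
    {M : X → Matrix (Fin m) (Fin m) ℝ} {x₀ : X} (hM : ContinuousAt (fun x => complexOp (M x)) x₀)
    {U : Set ℂ} (hU : IsOpen U) (hs : spectrum ℂ (complexOp (M x₀)) ⊆ U) :
    ∀ᶠ x in 𝓝 x₀, spectrum ℂ (complexOp (M x)) ⊆ U :=
  hM.eventually
    (upperHemicontinuousAt_iff_forall_isOpen.1 (upperHemicontinuous_spectrum ℂ _ _) U hU hs)

theorem exists_implicitFunction_totalProj {Y F : Type*} [NormedAddCommGroup Y] [NormedSpace ℝ Y]
    [CompleteSpace Y] [NormedAddCommGroup F] [NormedSpace ℝ F]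
    {M : Y × F → Matrix (Fin m) (Fin m) ℝ} {v : Y × F → State m} {v' : Y × F →L[ℝ] State m}
    {x₀ : Y × F} {c r : ℝ} (hr : 0 < r) (hM : LipschitzNear (fun x => complexOp (M x)) x₀)
    (hdiag : ∀ᶠ x in 𝓝 x₀, IsDiagonalizable (M x))
    (hspec : spectrum ℝ (M x₀) ∩ closedBall c r ⊆ {c})
    (hv : HasStrictFDerivAt v v' x₀) (h0 : v x₀ = 0)
    (hinj : Function.Injective (v' ∘L .inr ℝ Y F))
    (hrange : LinearMap.range (v' ∘L .inr ℝ Y F : F →ₗ[ℝ] State m) =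
      Module.End.eigenspace
        (Matrix.toEuclideanCLM (𝕜 := ℝ) (M x₀) : State m →ₗ[ℝ] State m) c) :
    ∃ φ : Y → F, Tendsto φ (𝓝 x₀.1) (𝓝 x₀.2) ∧
      ∀ᶠ x in 𝓝 x₀, totalProj c r (M x) (complexVec (v x)) = 0 ↔ φ x.1 = x.2 := by
  have : FiniteDimensional ℝ F := .of_injective (v' ∘L .inr ℝ Y F : F →ₗ[ℝ] State m) hinj
  have : CompleteSpace F := FiniteDimensional.complete ℝ F
  have hdiag₀ := hdiag.self_of_nhds
  have hcircle : sphere (c : ℂ) r ⊆ resolventSet ℂ (complexOp (M x₀)) :=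
    hdiag₀.sphere_subset_resolventSet_iff.2 <| Set.disjoint_left.2 fun t ht htr => by
      rw [hspec ⟨ht, sphere_subset_closedBall htr⟩, mem_sphere, dist_self] at htr
      exact hr.ne htr
  have hoff := eventually_disjoint_spectrum_sphere hM.continuousAt hdiag hcircle
  obtain ⟨φ, hφ, hiff⟩ := exists_implicitFunction_of_idempotent
    (lipschitzNear_reOp_totalProj hM hr.le hcircle)
    ((hdiag.and hoff).mono fun x hx => hx.1.isIdempotentElem_reOp_totalProj hr hx.2)
    hv h0 (.of_injective_of_finiteDimensional hinj)
    ((hdiag₀.range_reOp_totalProj hr hspec).trans hrange.symm)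
  refine ⟨φ, hφ, ?_⟩
  filter_upwards [hdiag, hoff, hiff] with x hx hxoff hxiff
  exact (hx.totalProj_complexVec_eq_zero_iff hr hxoff).trans hxiff

end TotalProjection

section Jacobian

theorem sum_finrank_eigenspace_le {K V ι : Type*} [Field K] [AddCommGroup V] [Module K V]
    [FiniteDimensional K V] [Fintype ι] (T : Module.End K V) {μ : ι → K}
    (hμ : Function.Injective μ) :
    ∑ i, Module.finrank K (T.eigenspace (μ i)) ≤ Module.finrank K V := by
  classical
  rw [← Module.finrank_directSum]
  exact LinearMap.finrank_le_finrank_of_injective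
    (T.eigenspaces_iSupIndep.comp hμ).dfinsupp_lsum_injective

theorem spectrum_subset_range_of_finrank_le_sum {K V ι : Type*} [Field K] [AddCommGroup V]
    [Module K V] [FiniteDimensional K V] [Fintype ι] {T : Module.End K V} {μ : ι → K}
    (hμ : Function.Injective μ)
    (hsum : Module.finrank K V ≤ ∑ i, Module.finrank K (T.eigenspace (μ i))) :
    spectrum K T ⊆ Set.range μ := by
  intro ν hν
  by_contra hνμ
  have hinj : Function.Injective (fun o : Option ι => o.elim ν μ) :=
    Option.injective_iff.2 ⟨hμ, hνμ⟩
  have hle : Module.finrank K (T.eigenspace ν) + ∑ i, Module.finrank K (T.eigenspace (μ i)) ≤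
      Module.finrank K V :=
    (Fintype.sum_option _).symm.trans_le (sum_finrank_eigenspace_le T hinj)
  have hbot : Module.finrank K (T.eigenspace ν) = 0 := by omega
  exact Module.End.hasEigenvalue_iff_mem_spectrum.2 hν (Submodule.finrank_eq_zero.1 hbot)

variable {m n k : ℕ} {f : State m → State m} {Ω : Set (State m)} {lam : Fin n → State m → ℝ}
  {p : Fin n → ℕ} {A : State m → State m → Matrix (Fin m) (Fin m) ℝ} {lamα : State m → ℝ}
  {D : Set (State m × EuclideanSpace ℝ (Fin k))} {W : State m → EuclideanSpace ℝ (Fin k) → State m}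
  {V : State m}

theorem eigSpace_eq_eigenspace (f : State m → State m) (V : State m) (μ : ℝ) :
    eigSpace f V μ = Module.End.eigenspace (fderiv ℝ f V : State m →ₗ[ℝ] State m) μ := by
  ext v
  simp [eigSpace, sub_eq_zero]

theorem IsHyperbolic.spectrum_fderiv_subset (hf : IsHyperbolic f Ω lam p) (hV : V ∈ Ω) :
    spectrum ℝ (fderiv ℝ f V : State m →ₗ[ℝ] State m) ⊆ Set.range fun β => lam β V := by
  refine spectrum_subset_range_of_finrank_le_sum (hf.strictMono V hV).injective ?_
  rw [finrank_euclideanSpace_fin]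
  refine hf.sum_eq.ge.trans (Finset.sum_le_sum fun β _ => ?_)
  rw [← eigSpace_eq_eigenspace, hf.finrank_eq V hV]

theorem IsAveragedMatrix.spectrum_diag (hA : IsAveragedMatrix f Ω A) (hV : V ∈ Ω) :
    spectrum ℝ (A V V) = spectrum ℝ (fderiv ℝ f V : State m →ₗ[ℝ] State m) := by
  rw [← hA.diag V hV, Matrix.coe_toEuclideanCLM_eq_toEuclideanLin,
    Matrix.spectrum_toLpLin]

theorem IsAveragedMatrix.lipschitzNear_diag (hA : IsAveragedMatrix f Ω A) (hΩ : Ω ∈ 𝓝 V)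
    (i j : Fin m) : LipschitzNear (fun q : State m × State m => A q.1 q.2 i j) (V, V) :=
  .of_hasStrictFDerivAt
    (((hA.smooth i j).contDiffAt (prod_mem_nhds hΩ hΩ)).hasStrictFDerivAt (by simp))

theorem IsAveragedMatrix.eventually_isDiagonalizable (hA : IsAveragedMatrix f Ω A)
    (hΩ : Ω ∈ 𝓝 V) : ∀ᶠ q in 𝓝 (V, V), IsDiagonalizable (A q.1 q.2) := by
  filter_upwards [prod_mem_nhds hΩ hΩ] with q hq
  obtain ⟨T, d, hT, hTd⟩ := hA.diagonalizable q.1 hq.1 q.2 hq.2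
  exact .of_mul_eq_mul_diagonal hT hTd

theorem IsCharacteristicParam.hasStrictFDerivAt (hW : IsCharacteristicParam f Ω lamα D W)
    (hV : V ∈ Ω) :
    HasStrictFDerivAt (fun q : State m × EuclideanSpace ℝ (Fin k) => W q.1 q.2)
      (fderiv ℝ (fun q : State m × EuclideanSpace ℝ (Fin k) => W q.1 q.2) (V, 0)) (V, 0) :=
  (hW.smooth.contDiffAt (hW.isOpen.mem_nhds (hW.zero_mem V hV))).hasStrictFDerivAt (by simp)

theorem IsCharacteristicParam.range_fderiv_comp_inr (hW : IsCharacteristicParam f Ω lamα D W)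
    (hV : V ∈ Ω) :
    LinearMap.range (fderiv ℝ (fun q : State m × EuclideanSpace ℝ (Fin k) => W q.1 q.2) (V, 0) ∘L
      .inr ℝ _ _ : EuclideanSpace ℝ (Fin k) →ₗ[ℝ] State m) = eigSpace f V (lamα V) := by
  have hpartial : HasFDerivAt (W V) _ 0 :=
    (hW.hasStrictFDerivAt hV).hasFDerivAt.comp (0 : EuclideanSpace ℝ (Fin k))
      (hasFDerivAt_prodMk_right V 0)
  have hspan := hW.span_eq V 0 (hW.zero_mem V hV)
  rw [hW.map_zero V hV, hpartial.fderiv] at hspan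
  rw [← hspan, LinearMap.range_eq_map, ← (EuclideanSpace.basisFun (Fin k) ℝ).toBasis.span_eq,
    Submodule.map_span, ← Set.range_comp]
  congr 2
  ext1 i
  simp

theorem IsCharacteristicParam.injective_fderiv_comp_inr
    (hW : IsCharacteristicParam f Ω lamα D W) (hV : V ∈ Ω)
    (hk : Module.finrank ℝ (eigSpace f V (lamα V)) = k) :
    Function.Injective (fderiv ℝ (fun q : State m × EuclideanSpace ℝ (Fin k) => W q.1 q.2) (V, 0) ∘L
      .inr ℝ _ _) := by
  have hrank := LinearMap.finrank_range_add_finrank_ker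
    (fderiv ℝ (fun q : State m × EuclideanSpace ℝ (Fin k) => W q.1 q.2) (V, 0) ∘L
      .inr ℝ _ _ : EuclideanSpace ℝ (Fin k) →ₗ[ℝ] State m)
  rw [hW.range_fderiv_comp_inr hV, hk, finrank_euclideanSpace_fin] at hrank
  exact LinearMap.ker_eq_bot.1 (Submodule.finrank_eq_zero.1 (by omega))

end Jacobian

section Jump

variable {m : ℕ} {F : Type*} [NormedAddCommGroup F] [NormedSpace ℝ F]
  {A : State m → State m → Matrix (Fin m) (Fin m) ℝ} {W : State m → F → State m}
  {W' : State m × F →L[ℝ] State m} {V : State m}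

theorem hasStrictFDerivAt_prodMk_param
    (hW : HasStrictFDerivAt (fun q : State m × F => W q.1 q.2) W' (V, 0)) :
    HasStrictFDerivAt (fun x : (State m × State m) × F => (W x.1.1 x.2, x.1.2))
      ((W' ∘L ((.fst ℝ _ _ ∘L .fst ℝ _ _).prod (.snd ℝ _ _))).prod (.snd ℝ _ _ ∘L .fst ℝ _ _))
      ((V, V), 0) := by
  let base : (State m × State m) × F →L[ℝ] State m × F :=
    (.fst ℝ _ _ ∘L .fst ℝ _ _).prod (.snd ℝ _ _)
  let right : (State m × State m) × F →L[ℝ] State m := .snd ℝ _ _ ∘L .fst ℝ _ _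
  exact (HasStrictFDerivAt.comp (f := base) ((V, V), (0 : F)) hW base.hasStrictFDerivAt).prodMk
    right.hasStrictFDerivAt

theorem lipschitzNear_complexOp_param
    (hA : ∀ i j, LipschitzNear (fun q : State m × State m => A q.1 q.2 i j) (V, V))
    (hW : HasStrictFDerivAt (fun q : State m × F => W q.1 q.2) W' (V, 0)) (hW₀ : W V 0 = V) :
    LipschitzNear (fun x : (State m × State m) × F => complexOp (A (W x.1.1 x.2) x.1.2))
      ((V, V), 0) := by
  have hAW : LipschitzNear (fun q : State m × State m => complexOp (A q.1 q.2)) (W V 0, V) := by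
    rw [hW₀]
    exact lipschitzNear_complexOp hA
  exact LipschitzNear.comp (g := fun q : State m × State m => complexOp (A q.1 q.2))
    (f := fun x : (State m × State m) × F => (W x.1.1 x.2, x.1.2)) (x₀ := ((V, V), 0)) hAW
    (.of_hasStrictFDerivAt (hasStrictFDerivAt_prodMk_param hW))

theorem exists_implicitFunction_totalProj_jump {c r : ℝ} (hr : 0 < r)
    (hA : ∀ i j, LipschitzNear (fun q : State m × State m => A q.1 q.2 i j) (V, V))
    (hdiag : ∀ᶠ q in 𝓝 (V, V), IsDiagonalizable (A q.1 q.2))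
    (hspec : spectrum ℝ (A V V) ∩ closedBall c r ⊆ {c})
    (hW : HasStrictFDerivAt (fun q : State m × F => W q.1 q.2) W' (V, 0)) (hW₀ : W V 0 = V)
    (hinj : Function.Injective (W' ∘L .inr ℝ _ _))
    (hrange : LinearMap.range (W' ∘L .inr ℝ _ _ : F →ₗ[ℝ] State m) =
      Module.End.eigenspace (Matrix.toEuclideanCLM (𝕜 := ℝ) (A V V) : State m →ₗ[ℝ] State m) c) :
    ∃ φ : State m × State m → F, Tendsto φ (𝓝 (V, V)) (𝓝 0) ∧
      ∀ᶠ x in 𝓝 ((V, V), (0 : F)), totalProj c r (A (W x.1.1 x.2) x.1.2)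
        (complexVec (x.1.2 - W x.1.1 x.2)) = 0 ↔ φ x.1 = x.2 := by
  have hg := hasStrictFDerivAt_prodMk_param hW
  have hg₀ : (W V 0, V) = (V, V) := by rw [hW₀]
  have hv := (ContinuousLinearMap.snd ℝ (State m) (State m) -
    ContinuousLinearMap.fst ℝ (State m) (State m)).hasStrictFDerivAt.comp ((V, V), (0 : F)) hg
  have hpartial : ((ContinuousLinearMap.snd ℝ (State m) (State m) -
      ContinuousLinearMap.fst ℝ (State m) (State m)) ∘L
      (W' ∘L ((.fst ℝ _ _ ∘L .fst ℝ _ _).prod (.snd ℝ _ _))).prod (.snd ℝ _ _ ∘L .fst ℝ _ _)) ∘L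
      .inr ℝ _ _ = -(W' ∘L .inr ℝ _ F) := by
    ext
    simp
  refine exists_implicitFunction_totalProj hr
    (M := fun x : (State m × State m) × F => A (W x.1.1 x.2) x.1.2)
    (lipschitzNear_complexOp_param hA hW hW₀) (hg.continuousAt.eventually (hg₀ ▸ hdiag))
    (by simpa only [hW₀] using hspec) hv (by simp [hW₀]) ?_ ?_
  · rw [hpartial]
    exact neg_injective.comp hinj
  · simp only [hW₀]
    rw [hpartial, ← hrange]
    exact LinearMap.range_neg _

theorem eventually_spectrum_complexOp_param_subset
    (hA : ∀ i j, LipschitzNear (fun q : State m × State m => A q.1 q.2 i j) (V, V))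
    (hdiag : IsDiagonalizable (A V V)) {ι : Type*} {μ : ι → ℝ}
    (hspec : spectrum ℝ (A V V) ⊆ Set.range μ) {r : ℝ} (hr : 0 < r)
    (hW : HasStrictFDerivAt (fun q : State m × F => W q.1 q.2) W' (V, 0)) (hW₀ : W V 0 = V) :
    ∀ᶠ x in 𝓝 ((V, V), (0 : F)),
      spectrum ℂ (complexOp (A (W x.1.1 x.2) x.1.2)) ⊆ ⋃ β, ball (μ β : ℂ) r := by
  refine eventually_spectrum_complexOp_subset
    (M := fun x : (State m × State m) × F => A (W x.1.1 x.2) x.1.2)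
    (lipschitzNear_complexOp_param hA hW hW₀).continuousAt
    (isOpen_iUnion fun _ => isOpen_ball) ?_
  simp only [hW₀]
  rw [hdiag.spectrum_complexOp]
  rintro _ ⟨t, ht, rfl⟩
  obtain ⟨β, rfl⟩ := hspec ht
  exact Set.mem_iUnion.2 ⟨β, mem_ball_self hr⟩

end Jump

theorem exists_radii_of_tendsto {Y F : Type*} [PseudoMetricSpace Y] [PseudoMetricSpace F]
    {φ : Y → F} {y₀ : Y} {s₀ : F} (hφ : Tendsto φ (𝓝 y₀) (𝓝 s₀)) {P : Y → F → Prop}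
    (hP : ∀ᶠ x in 𝓝 (y₀, s₀), P x.1 x.2) {ε₀ : ℝ} (hε₀ : 0 < ε₀) :
    ∃ δ₀ : ℝ, 0 < δ₀ ∧ ∀ δ : ℝ, 0 < δ → δ ≤ δ₀ →
      ∃ ε : ℝ, 0 < ε ∧ ε < ε₀ ∧
        ∀ y ∈ closedBall y₀ ε, φ y ∈ ball s₀ δ ∧ ∀ s ∈ ball s₀ δ, P y s := by
  rw [nhds_prod_eq] at hP
  obtain ⟨p, hp, q, hq, hpq⟩ := eventually_prod_iff.1 hP
  obtain ⟨δ₀, hδ₀, hball⟩ := Metric.eventually_nhds_iff_ball.1 hq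
  refine ⟨δ₀, hδ₀, fun δ hδ hle => ?_⟩
  obtain ⟨ε, hε, hclosed⟩ := nhds_basis_closedBall.eventually_iff.1
    (hp.and (hφ.eventually (ball_mem_nhds s₀ hδ)))
  refine ⟨min ε (ε₀ / 2), by positivity, (min_le_right _ _).trans_lt (half_lt_self hε₀),
    fun y hy => ?_⟩
  obtain ⟨hpy, hφy⟩ := hclosed (closedBall_subset_closedBall (min_le_left _ _) hy)
  exact ⟨hφy, fun s hs => hpq hpy (hball s (ball_subset_ball hle hs))⟩

theorem inter_closedBall_subset_singleton {ι : Type*} {S : Set ℝ} {μ : ι → ℝ}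
    (hS : S ⊆ Set.range μ) {r : ℝ} (hr : 0 < r) (hgap : ∀ β γ, β ≠ γ → 2 * r < |μ β - μ γ|)
    (α : ι) : S ∩ closedBall (μ α) r ⊆ {μ α} := by
  rintro t ⟨htS, htr⟩
  obtain ⟨β, rfl⟩ := hS htS
  by_contra hne
  have hlt := hgap β α fun h => hne (congrArg μ h)
  rw [mem_closedBall, Real.dist_eq] at htr
  linarith

end SteadyFlow

open SteadyFlow Filter Topology in
theorem lemma3_general {m : ℕ} {ι F : Type*} [NormedAddCommGroup F] [NormedSpace ℝ F]
    (Vbar : State m) (ε₀ : ℝ) (hε₀ : 0 < ε₀) (A : State m → State m → Matrix (Fin m) (Fin m) ℝ)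
    (hA : ∀ i j, LipschitzNear (fun q : State m × State m => A q.1 q.2 i j) (Vbar, Vbar))
    (hdiag : ∀ᶠ q in 𝓝 (Vbar, Vbar), IsDiagonalizable (A q.1 q.2))
    (μ : ι → ℝ) (hspec : spectrum ℝ (A Vbar Vbar) ⊆ Set.range μ) (α : ι)
    (D : Set (State m × F)) (hD : D ∈ 𝓝 (Vbar, 0)) (W : State m → F → State m)
    (W' : State m × F →L[ℝ] State m)
    (hW : HasStrictFDerivAt (fun q : State m × F => W q.1 q.2) W' (Vbar, 0))
    (hW₀ : W Vbar 0 = Vbar) (hinj : Function.Injective (W' ∘L .inr ℝ _ _))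
    (hrange : LinearMap.range (W' ∘L .inr ℝ _ _ : F →ₗ[ℝ] State m) = Module.End.eigenspace
      (Matrix.toEuclideanCLM (𝕜 := ℝ) (A Vbar Vbar) : State m →ₗ[ℝ] State m) (μ α))
    (r : ℝ) (hr : 0 < r) (hgap : ∀ β γ : ι, β ≠ γ → 2 * r < |μ β - μ γ|) :
    ∃ δ₀ : ℝ, 0 < δ₀ ∧ ∀ δ : ℝ, 0 < δ → δ ≤ δ₀ →
      ∃ ε : ℝ, 0 < ε ∧ ε < ε₀ ∧
        ∀ Vm ∈ Metric.closedBall Vbar ε, ∀ V ∈ Metric.closedBall Vbar ε,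
          (∀ s ∈ Metric.ball (0 : F) δ, (Vm, s) ∈ D ∧
            ∀ z ∈ spectrum ℂ (complexOp (A (W Vm s) V)), ∃ β : ι, ‖z - (μ β : ℂ)‖ < r) ∧
          ∃! s : F, s ∈ Metric.ball (0 : F) δ ∧
            totalProj (μ α) r (A (W Vm s) V) (complexVec (V - W Vm s)) = 0 := by
  obtain ⟨φ, hφ, hiff⟩ := exists_implicitFunction_totalProj_jump hr hA hdiag
    (inter_closedBall_subset_singleton hspec hr hgap α) hW hW₀ hinj hrange
  have hloc := eventually_spectrum_complexOp_param_subset hA hdiag.self_of_nhds hspec hr hW hW₀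
  have hdom : ∀ᶠ x in 𝓝 ((Vbar, Vbar), (0 : F)), (x.1.1, x.2) ∈ D :=
    (by fun_prop : Continuous fun x : (State m × State m) × F => (x.1.1, x.2)).continuousAt hD
  obtain ⟨δ₀, hδ₀, hradii⟩ := exists_radii_of_tendsto hφ
    (P := fun y s => (y.1, s) ∈ D ∧
      spectrum ℂ (complexOp (A (W y.1 s) y.2)) ⊆ ⋃ β, Metric.ball (μ β : ℂ) r ∧
      (totalProj (μ α) r (A (W y.1 s) y.2) (complexVec (y.2 - W y.1 s)) = 0 ↔ φ y = s))
    (hdom.and (hloc.and hiff)) hε₀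
  refine ⟨δ₀, hδ₀, fun δ hδ hle => ?_⟩
  obtain ⟨ε, hε, hlt, hball⟩ := hradii δ hδ hle
  refine ⟨ε, hε, hlt, fun Vm hVm V hV => ?_⟩
  obtain ⟨hφδ, hs⟩ := hball (Vm, V) (closedBall_prod_same Vbar Vbar ε ▸ ⟨hVm, hV⟩)
  refine ⟨fun s hsδ => ⟨(hs s hsδ).1, fun z hz => ?_⟩, φ (Vm, V), ⟨hφδ, ?_⟩, fun s hsV => ?_⟩
  · simpa only [Set.mem_iUnion, mem_ball_iff_norm] using (hs s hsδ).2.1 hz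
  · exact (hs _ hφδ).2.2.2 rfl
  · exact ((hs s hsV.1).2.2.1 hsV.2).symm

theorem lemma3 {m n : ℕ} (f : SteadyFlow.State m → SteadyFlow.State m)
    (Vbar : SteadyFlow.State m) (ε₀ : ℝ) (hε₀ : 0 < ε₀)
    (lam : Fin n → SteadyFlow.State m → ℝ) (p : Fin n → ℕ)
    (hf : SteadyFlow.IsHyperbolic f (Metric.ball Vbar ε₀) lam p)
    (A : SteadyFlow.State m → SteadyFlow.State m → Matrix (Fin m) (Fin m) ℝ)
    (hA : SteadyFlow.IsAveragedMatrix f (Metric.ball Vbar ε₀) A)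
    (α : Fin n)
    (D : Set (SteadyFlow.State m × EuclideanSpace ℝ (Fin (p α))))
    (W : SteadyFlow.State m → EuclideanSpace ℝ (Fin (p α)) → SteadyFlow.State m)
    (hW : SteadyFlow.IsCharacteristicParam f (Metric.ball Vbar ε₀) (lam α) D W)
    (r : ℝ) (hr : 0 < r)
    (hgap : ∀ β γ : Fin n, β ≠ γ → 2 * r < |lam β Vbar - lam γ Vbar|) :
    ∃ δ₀ : ℝ, 0 < δ₀ ∧ ∀ δ : ℝ, 0 < δ → δ ≤ δ₀ →
      ∃ ε : ℝ, 0 < ε ∧ ε < ε₀ ∧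
        ∀ Vm ∈ Metric.closedBall Vbar ε, ∀ V ∈ Metric.closedBall Vbar ε,
          (∀ s ∈ Metric.ball (0 : EuclideanSpace ℝ (Fin (p α))) δ,
            (Vm, s) ∈ D ∧
            ∀ z ∈ spectrum ℂ (SteadyFlow.complexOp (A (W Vm s) V)),
              ∃ β : Fin n, ‖z - (lam β Vbar : ℂ)‖ < r) ∧
          ∃! s : EuclideanSpace ℝ (Fin (p α)),
            s ∈ Metric.ball (0 : EuclideanSpace ℝ (Fin (p α))) δ ∧
            SteadyFlow.totalProj (lam α Vbar) r (A (W Vm s) V)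
              (SteadyFlow.complexVec (V - W Vm s)) = 0 := by
  have hV := Metric.mem_ball_self (x := Vbar) hε₀
  have hΩ := Metric.ball_mem_nhds Vbar hε₀
  refine lemma3_general Vbar ε₀ hε₀ A (hA.lipschitzNear_diag hΩ) (hA.eventually_isDiagonalizable hΩ)
    (fun β => lam β Vbar) ((hA.spectrum_diag hV).trans_subset (hf.spectrum_fderiv_subset hV)) α
    D (hW.isOpen.mem_nhds (hW.zero_mem Vbar hV)) W _ (hW.hasStrictFDerivAt hV)
    (hW.map_zero Vbar hV) (hW.injective_fderiv_comp_inr hV (hf.finrank_eq Vbar hV α)) ?_ r hr hgap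
  rw [hW.range_fderiv_comp_inr hV, SteadyFlow.eigSpace_eq_eigenspace, hA.diag Vbar hV]
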